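/- **Theorem (Majorizing inequality for generalized derangements).** For nonnegative integers $t_1,\dots,t_n$, let $P(t_1,\dots,t_n)$ denote the number of generalized derangements of $\bigcup_{i=1}^n T_i$, where $T_1,\dots,T_n$ are pairwise disjoint finite sets with $|T_i|=t_i$ (empty sets are allowed); here a generalized derangement is a permutation $\sigma$ of $\bigcup_{i=1}^n T_i$ such that $\sigma(x)\notin T_i$ for every $i$ and every $x\in T_i$. Let $(a_i)_{i=1}^n$ and $(b_i)_{i=1}^n$ be two sequences of nonnegative integers such that $(a_i)$ majorizes $(b_i)$, that is, $\sum_{i=1}^n a_i=\sum_{i=1}^n b_i$ and, for every $k\le n$, the sum of the $k$ largest terms of $(a_i)$ is at least the sum of the $k$ largest terms of $(b_i)$. Then $$P(a_1,\dots,a_n)\le P(b_1,\dots,b_n).$$ -/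

import Mathlib

/-- `σ` is a generalized derangement of the union of the sets `T i`: it is a permutation of that
union, and it sends no element to an element of its own set. -/
def IsGenDerangement {ι α : Type*} (T : ι → Set α) (σ : Equiv.Perm (⋃ i, T i : Set α)) : Prop :=
  ∀ (i : ι) (a : (⋃ i, T i : Set α)), (a : α) ∈ T i → (σ a : α) ∉ T i

/-- `P(t₁, …, tₙ)`: the number of generalized derangements of a disjoint union of `n` finite sets
with `t₁, …, tₙ` elements. The disjoint union is realized as the sigma type `Σ i, Fin (t i)`, in
which `x.1` is the index of the set that contains `x`. -/
noncomputable def genDerangementCount {n : ℕ} (t : Fin n → ℕ) : ℕ :=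
  Nat.card {σ : Equiv.Perm (Σ i, Fin (t i)) // ∀ x, (σ x).1 ≠ x.1}

/-- The number of generalized derangements depends only on the sizes of the sets, so it is
`genDerangementCount` for every family of pairwise disjoint finite sets. -/
theorem card_isGenDerangement {n : ℕ} {α : Type*} (T : Fin n → Set α)
    (hfin : ∀ i, (T i).Finite) (hdisj : Pairwise (Function.onFun Disjoint T)) :
    Nat.card {σ : Equiv.Perm (⋃ i, T i : Set α) // IsGenDerangement T σ} =
      genDerangementCount (fun i => (T i).ncard) := by
  have hf : ∀ i, Nonempty (T i ≃ Fin (T i).ncard) := fun i => by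
    have := (hfin i).to_subtype
    exact ⟨Finite.equivFinOfCardEq (Nat.card_coe_set_eq (T i))⟩
  let f := fun i => (hf i).some
  let e : (⋃ i, T i : Set α) ≃ Σ i, Fin (T i).ncard :=
    (Set.unionEqSigmaOfDisjoint hdisj).trans (Equiv.sigmaCongrRight f)
  have he : ∀ (i : Fin n) (a : (⋃ i, T i : Set α)), (a : α) ∈ T i ↔ (e a).1 = i := by
    intro i a
    have h1 : (a : α) ∈ T (e a).1 := by
      have h2 : (((Set.unionEqSigmaOfDisjoint hdisj).symm
          (Set.unionEqSigmaOfDisjoint hdisj a) : (⋃ i, T i : Set α)) : α) ∈ T (e a).1 :=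
        ((Set.unionEqSigmaOfDisjoint hdisj) a).2.2
      rwa [Equiv.symm_apply_apply] at h2
    constructor
    · intro h
      by_contra hne
      exact Set.disjoint_left.1 (hdisj hne) h1 h
    · rintro rfl
      exact h1
  refine Nat.card_congr (Equiv.subtypeEquiv (e.permCongr) fun σ => ?_)
  simp only [IsGenDerangement, he, Equiv.permCongr_apply]
  constructor
  · intro h x
    have := h _ (e.symm x) rfl
    simpa using this
  · rintro h i a rfl
    simpa using h (e a)

/-- The decreasing rearrangement of a finite sequence. -/
def decreasingRearrangement {n : ℕ} (a : Fin n → ℕ) : Fin n → ℕ :=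
  fun i => a (Tuple.sort a i.rev)

/-- The decreasing rearrangement is decreasing; it is a rearrangement by definition. -/
theorem antitone_decreasingRearrangement {n : ℕ} (a : Fin n → ℕ) :
    Antitone (decreasingRearrangement a) :=
  fun _ _ h => Tuple.monotone_sort a (Fin.rev_le_rev.2 h)

/-- `a` majorizes `b`: both have the same sum, and for every `k ≤ n` the sum of the `k` largest
entries of `a` is at least the sum of the `k` largest entries of `b`. -/
def Majorizes {n : ℕ} (a b : Fin n → ℕ) : Prop :=
  (∀ k ≤ n, ∑ i with (i : Fin n).val < k, decreasingRearrangement b i ≤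
      ∑ i with (i : Fin n).val < k, decreasingRearrangement a i) ∧
    ∑ i, a i = ∑ i, b i

open Equiv Finset

/-! Write `P(t)` for the count and `e_i` for a unit in entry `i`. Deleting a new point `∗` of fibre
`i` from its cycle `z → ∗ → y` leaves a permutation `τ` with `τ z = y`. The original is a
derangement iff `τ` is one except possibly at `z`, and neither `y` nor `z` lies in fibre `i`. Among
all pairs `(y, τ)` with `τ` good off `z`, those with exactly one of `y`, `z` in fibre `i` number `2
t_i P(t)`, and those with both number `t_i² P(t - e_i)`. Hence `P(t + e_i) + 2 t_i P(t) + t_i² P(t -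
e_i)` does not depend on `i`. Comparing this for `i` and `j` with `t_j ≤ t_i` gives `P(t + e_i) ≤
P(t + e_j)` by induction on `t_j` (`genDerangementCount_transfer`). Majorization reduces to such
unit transfers (`exists_transfer`). -/

/-- The permutations that move every point out of its fibre under `c`. -/
def IsFibreDerangement {X ι : Type*} (c : X → ι) (σ : Perm X) : Prop :=
  ∀ x, c (σ x) ≠ c x

/-- The permutations that move every point out of its fibre under `c`, except possibly the
preimage of `y`. -/
def IsFibreDerangementOff {X ι : Type*} (c : X → ι) (y : X) (σ : Perm X) : Prop :=
  ∀ x, σ x ≠ y → c (σ x) ≠ c x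

/-- The number of permutations that move every point out of its fibre under `c`. -/
noncomputable def fibreDerangementCount {X ι : Type*} (c : X → ι) : ℕ :=
  Nat.card {σ : Perm X // IsFibreDerangement c σ}

/-- Adjoin one point to a type fibred over `ι`, in the fibre over `i`. -/
def adjoinPoint {X ι : Type*} (c : X → ι) (i : ι) : Option X → ι := fun x => x.elim i c

/-! ### Inserting a point into a cycle -/

section Counting

open scoped Classical in
theorem natCard_subtype_eq_sum {α : Type*} [Fintype α] (p : α → Prop) :
    Nat.card {a // p a} = ∑ a, if p a then 1 else 0 := by
  rw [Nat.card_eq_fintype_card, Fintype.card_subtype, Finset.card_filter]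

theorem fibreDerangementCount_congr {X Y ι κ : Type*} (c : X → ι) (d : Y → κ) (e : X ≃ Y)
    (h : ∀ x y, d (e x) = d (e y) ↔ c x = c y) :
    fibreDerangementCount c = fibreDerangementCount d := by
  refine Nat.card_congr (Equiv.subtypeEquiv e.permCongr fun σ => ?_)
  simp only [IsFibreDerangement, Equiv.permCongr_apply]
  constructor
  · intro hσ y
    have h1 := h (σ (e.symm y)) (e.symm y)
    rw [e.apply_symm_apply] at h1
    rw [Ne, h1]
    exact hσ _
  · intro hσ x
    have h1 := hσ (e x)
    rwa [e.symm_apply_apply, Ne, h] at h1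

theorem exists_equiv_of_card_fibre {X Y ι : Type*} [Finite X] [Finite Y]
    (c : X → ι) (d : Y → ι) (h : ∀ i, Nat.card {x // c x = i} = Nat.card {y // d y = i}) :
    ∃ e : X ≃ Y, ∀ x, d (e x) = c x := by
  have f : ∀ i, {x // c x = i} ≃ {y // d y = i} := fun i => (Finite.card_eq.1 (h i)).some
  exact ⟨(Equiv.sigmaFiberEquiv c).symm.trans
    ((Equiv.sigmaCongrRight f).trans (Equiv.sigmaFiberEquiv d)), fun x => (f (c x) ⟨x, rfl⟩).2⟩

theorem fibreDerangementCount_eq_of_card_fibre {X Y ι : Type*} [Finite X] [Finite Y]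
    (c : X → ι) (d : Y → ι) (h : ∀ i, Nat.card {x // c x = i} = Nat.card {y // d y = i}) :
    fibreDerangementCount c = fibreDerangementCount d := by
  obtain ⟨e, he⟩ := exists_equiv_of_card_fibre c d h
  exact fibreDerangementCount_congr c d e fun x y => by rw [he, he]

variable {X ι : Type*}

theorem isFibreDerangement_adjoinPoint_none [DecidableEq X] (c : X → ι) (i : ι) (τ : Perm X) :
    ¬ IsFibreDerangement (adjoinPoint c i) (Equiv.Perm.decomposeOption.symm (none, τ)) := by
  intro h
  exact h none (by simp)

/-- `decomposeOption.symm (some y, τ)` inserts `none` into the cycle of `τ` just before `y`; only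
the arrows into and out of `none` are new. -/
theorem isFibreDerangement_adjoinPoint_some [DecidableEq X] (c : X → ι) (i : ι) (y : X) (τ : Perm X) :
    IsFibreDerangement (adjoinPoint c i) (Equiv.Perm.decomposeOption.symm (some y, τ)) ↔
      IsFibreDerangementOff c y τ ∧ c y ≠ i ∧ c (τ.symm y) ≠ i := by
  have hnone : Equiv.Perm.decomposeOption.symm (some y, τ) none = some y := by simp
  have heq : ∀ x, τ x = y → Equiv.Perm.decomposeOption.symm (some y, τ) (some x) = none := by
    intro x hx; simp [hx]
  have hne : ∀ x, τ x ≠ y →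
      Equiv.Perm.decomposeOption.symm (some y, τ) (some x) = some (τ x) := by
    intro x hx
    simp only [Equiv.Perm.decomposeOption_symm_apply, Equiv.Perm.coe_mul, Function.comp_apply,
      Equiv.optionCongr_apply, Option.map_some]
    exact Equiv.swap_apply_of_ne_of_ne (by simp) (by simpa using hx)
  constructor
  · intro h
    refine ⟨fun x hx => ?_, ?_, ?_⟩
    · have := h (some x)
      rwa [hne x hx] at this
    · have := h none
      rwa [hnone] at this
    · have := h (some (τ.symm y))
      rw [heq _ (τ.apply_symm_apply y)] at this
      exact this.symm
  · rintro ⟨h1, h2, h3⟩ (_ | x)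
    · rw [hnone]; exact h2
    · by_cases hx : τ x = y
      · rw [heq x hx]
        have : x = τ.symm y := by rw [← hx, τ.symm_apply_apply]
        rw [this]; exact h3.symm
      · rw [hne x hx]; exact h1 x hx

/-- The pairs `(y, τ)` for which `τ` fails to be a fibre derangement at most at the preimage of
`y`. -/
noncomputable def offCount (c : X → ι) : ℕ :=
  Nat.card {p : X × Perm X // IsFibreDerangementOff c p.1 p.2}

/-- The pairs `(y, τ)` for which `τ` fails to be a fibre derangement exactly at the preimage of
`y`, and `y` lies over `i`. -/
noncomputable def defectCount (c : X → ι) (i : ι) : ℕ :=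
  Nat.card {p : X × Perm X //
    IsFibreDerangementOff c p.1 p.2 ∧ c p.1 = i ∧ c (p.2.symm p.1) = i}

theorem fibreDerangementCount_adjoinPoint [Fintype X] (c : X → ι) (i : ι) :
    fibreDerangementCount (adjoinPoint c i) = Nat.card {p : X × Perm X //
      IsFibreDerangementOff c p.1 p.2 ∧ c p.1 ≠ i ∧ c (p.2.symm p.1) ≠ i} := by
  classical
  rw [fibreDerangementCount, natCard_subtype_eq_sum, natCard_subtype_eq_sum,
    ← Equiv.sum_comp Equiv.Perm.decomposeOption.symm, Fintype.sum_prod_type,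
    Fintype.sum_option, Fintype.sum_prod_type]
  simp only [isFibreDerangement_adjoinPoint_none, isFibreDerangement_adjoinPoint_some,
    if_false, Finset.sum_const_zero, zero_add]
  refine Finset.sum_congr rfl fun y _ => Finset.sum_congr rfl fun τ _ => ?_
  congr

theorem isFibreDerangement_of_off {c : X → ι} {y : X} {τ : Perm X}
    (h : IsFibreDerangementOff c y τ) (hy : c y ≠ c (τ.symm y)) : IsFibreDerangement c τ := by
  intro x
  by_cases hx : τ x = y
  · have : x = τ.symm y := by rw [← hx, τ.symm_apply_apply]
    rw [hx, this]; exact hy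
  · exact h x hx

/-- The endpoints of the exempt arrow lie in different fibres, so `τ` is a full derangement;
conversely, for a derangement the condition on the preimage is automatic, so `y` and `τ` are
independent. -/
theorem natCard_off_left (c : X → ι) (i : ι) :
    Nat.card {p : X × Perm X //
      IsFibreDerangementOff c p.1 p.2 ∧ c p.1 = i ∧ c (p.2.symm p.1) ≠ i} =
      Nat.card {x // c x = i} * fibreDerangementCount c := by
  rw [fibreDerangementCount, ← Nat.card_prod]
  refine Nat.card_congr ((Equiv.subtypeEquivRight fun p => ?_).trans
    Equiv.subtypeProdEquivProd)
  constructor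
  · rintro ⟨h, h1, h2⟩
    exact ⟨h1, isFibreDerangement_of_off h (by rw [h1]; exact h2.symm)⟩
  · rintro ⟨h1, h⟩
    refine ⟨fun x _ => h x, h1, fun h2 => h (p.2.symm p.1) ?_⟩
    rw [p.2.apply_symm_apply, h1, h2]

theorem natCard_off_right (c : X → ι) (i : ι) :
    Nat.card {p : X × Perm X //
      IsFibreDerangementOff c p.1 p.2 ∧ c p.1 ≠ i ∧ c (p.2.symm p.1) = i} =
      Nat.card {x // c x = i} * fibreDerangementCount c := by
  rw [fibreDerangementCount, ← Nat.card_prod]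
  -- Record the preimage of `y` instead of `y`.
  let e : X × Perm X ≃ X × Perm X :=
    { toFun := fun p => (p.2.symm p.1, p.2)
      invFun := fun p => (p.2 p.1, p.2)
      left_inv := fun p => by simp
      right_inv := fun p => by simp }
  refine Nat.card_congr ((Equiv.subtypeEquiv e fun p => ?_).trans
    Equiv.subtypeProdEquivProd)
  change _ ↔ c (p.2.symm p.1) = i ∧ IsFibreDerangement c p.2
  constructor
  · rintro ⟨h, h1, h2⟩
    exact ⟨h2, isFibreDerangement_of_off h (by rw [h2]; exact h1)⟩
  · rintro ⟨h2, h⟩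
    refine ⟨fun x _ => h x, fun h1 => h (p.2.symm p.1) ?_, h2⟩
    rw [p.2.apply_symm_apply, h1]
    exact h2.symm

/-- Inserting a point into a cycle: the left-hand side does not depend on the fibre `i` to which
the point is adjoined. -/
theorem fibreDerangementCount_adjoinPoint_add [Fintype X] (c : X → ι) (i : ι) :
    fibreDerangementCount (adjoinPoint c i) +
      2 * (Nat.card {x // c x = i} * fibreDerangementCount c) + defectCount c i = offCount c := by
  classical
  rw [two_mul]
  nth_rewrite 1 [← natCard_off_left]
  rw [← natCard_off_right, fibreDerangementCount_adjoinPoint, defectCount, offCount]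
  simp only [natCard_subtype_eq_sum, ← Finset.sum_add_distrib]
  refine Finset.sum_congr rfl fun p _ => ?_
  by_cases h : IsFibreDerangementOff c p.1 p.2 <;> by_cases h1 : c p.1 = i <;>
    by_cases h2 : c (p.2.symm p.1) = i <;> simp [h, h1, h2]

/-- Composing on either side with a swap inside one fibre preserves the fibre of every point and of
every image. -/
theorem natCard_off_eq [DecidableEq X] (c : X → ι) {i : ι} (y z y' z' : X) (hy : c y = i) (hz : c z = i)
    (hy' : c y' = i) (hz' : c z' = i) :
    Nat.card {τ : Perm X // IsFibreDerangementOff c y τ ∧ τ.symm y = z} =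
      Nat.card {τ : Perm X // IsFibreDerangementOff c y' τ ∧ τ.symm y' = z'} := by
  have hswap : ∀ {u v : X}, c u = i → c v = i → ∀ x, c (swap u v x) = c x := by
    intro u v hu hv x
    rw [swap_apply_def]
    split_ifs with h1 h2
    · rw [h1, hu, hv]
    · rw [h2, hu, hv]
    · rfl
  let e : Perm X ≃ Perm X := (Equiv.mulRight (swap z z')).trans (Equiv.mulLeft (swap y y'))
  have he : ∀ τ x, e τ x = swap y y' (τ (swap z z' x)) := fun τ x => rfl
  refine Nat.card_congr (Equiv.subtypeEquiv e fun τ => ?_)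
  simp only [IsFibreDerangementOff, Equiv.symm_apply_eq]
  have hval : y' = e τ z' ↔ y = τ z := by
    rw [he, swap_apply_right, ← Equiv.symm_apply_eq, symm_swap, swap_apply_right]
  rw [hval]
  refine and_congr_left fun _ => ?_
  constructor
  · intro h x hx
    rw [he, hswap hy hy', ← hswap hz hz' x]
    refine h _ fun h' => hx ?_
    rw [he, h', swap_apply_left]
  · intro h x hx
    have := h (swap z z' x) fun h' => hx ?_
    · rwa [he, swap_apply_self, hswap hy hy', hswap hz hz'] at this
    · rw [he, swap_apply_self] at h'
      rw [← Equiv.eq_symm_apply, symm_swap, swap_apply_right] at h'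
      exact h'

theorem natCard_off_none [Fintype X] (c : X → ι) (i : ι) :
    Nat.card {τ : Perm (Option X) //
      IsFibreDerangementOff (adjoinPoint c i) none τ ∧ τ.symm none = none} =
      fibreDerangementCount c := by
  classical
  have hnone : ∀ τ : Perm X, (IsFibreDerangementOff (adjoinPoint c i) none
      (Equiv.Perm.decomposeOption.symm (none, τ)) ∧
      (Equiv.Perm.decomposeOption.symm (none, τ)).symm none = none) ↔
      IsFibreDerangement c τ := by
    intro τ
    rw [Equiv.symm_apply_eq]
    have h0 : ∀ x, Equiv.Perm.decomposeOption.symm (none, τ) x = x.map τ := fun x => by simp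
    simp only [IsFibreDerangementOff, h0]
    constructor
    · intro h x
      exact h.1 (some x) (by simp)
    · intro h
      refine ⟨?_, rfl⟩
      rintro (_ | x) hx
      · exact absurd rfl hx
      · exact h x
  have hsome : ∀ (y : X) (τ : Perm X), ¬ (IsFibreDerangementOff (adjoinPoint c i) none
      (Equiv.Perm.decomposeOption.symm (some y, τ)) ∧
      (Equiv.Perm.decomposeOption.symm (some y, τ)).symm none = none) := by
    rintro y τ ⟨-, h⟩
    rw [Equiv.symm_apply_eq] at h
    simp at h
  rw [fibreDerangementCount, natCard_subtype_eq_sum, natCard_subtype_eq_sum,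
    ← Equiv.sum_comp Equiv.Perm.decomposeOption.symm, Fintype.sum_prod_type,
    Fintype.sum_option]
  simp only [hnone, hsome, if_false, Finset.sum_const_zero, add_zero]

theorem defectCount_eq_zero (c : X → ι) (i : ι) (h : ∀ x, c x ≠ i) : defectCount c i = 0 := by
  have : IsEmpty {p : X × Perm X //
      IsFibreDerangementOff c p.1 p.2 ∧ c p.1 = i ∧ c (p.2.symm p.1) = i} :=
    ⟨fun p => h _ p.2.2.1⟩
  exact Nat.card_of_isEmpty

/-- Sum over the endpoints `y`, `z` in fibre `i` of the exempt arrow. Each term equals the one with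
`y = z = none`, where the adjoined point is fixed and can be dropped. -/
theorem defectCount_adjoinPoint [Fintype X] (c : X → ι) (i : ι) :
    defectCount (adjoinPoint c i) i =
      Nat.card {x // adjoinPoint c i x = i} ^ 2 * fibreDerangementCount c := by
  classical
  set d := adjoinPoint c i with hd
  have hsum : defectCount d i = ∑ y, ∑ z, if d y = i then if d z = i then
      Nat.card {τ : Perm (Option X) // IsFibreDerangementOff d y τ ∧ τ.symm y = z}
      else 0 else 0 := by
    rw [defectCount, natCard_subtype_eq_sum, Fintype.sum_prod_type]
    refine Finset.sum_congr rfl fun y _ => ?_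
    by_cases hy : d y = i
    · simp only [hy, if_true, true_and]
      have : ∀ z, (if d z = i then
          Nat.card {τ : Perm (Option X) // IsFibreDerangementOff d y τ ∧ τ.symm y = z} else 0) =
          ∑ τ : Perm (Option X), if τ.symm y = z then
            (if IsFibreDerangementOff d y τ ∧ d (τ.symm y) = i then 1 else 0) else 0 := by
        intro z
        by_cases hz : d z = i
        · rw [if_pos hz, natCard_subtype_eq_sum]
          refine Finset.sum_congr rfl fun τ _ => ?_
          by_cases hτ : τ.symm y = z <;> simp [hτ, hz]
        · rw [if_neg hz]
          refine (Finset.sum_eq_zero fun τ _ => ?_).symm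
          by_cases hτ : τ.symm y = z <;> simp [hτ, hz]
      simp only [this]
      rw [Finset.sum_comm]
      refine Finset.sum_congr rfl fun τ _ => ?_
      rw [Finset.sum_ite_eq, if_pos (Finset.mem_univ _)]
    · simp [hy]
  have hconst : ∀ y z, (if d y = i then if d z = i then
      Nat.card {τ : Perm (Option X) // IsFibreDerangementOff d y τ ∧ τ.symm y = z}
      else 0 else 0) =
      (if d y = i then 1 else 0) * ((if d z = i then 1 else 0) * fibreDerangementCount c) := by
    intro y z
    split_ifs with hy hz
    · rw [natCard_off_eq d y z none none hy hz rfl rfl, natCard_off_none, one_mul, one_mul]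
    · simp
    · simp
    · simp
  rw [hsum]
  simp only [hconst, ← Finset.mul_sum, ← Finset.sum_mul]
  rw [natCard_subtype_eq_sum, sq, mul_assoc]

end Counting

/-! ### The recurrence and unit transfers -/

section Recurrence

variable {n : ℕ}

theorem genDerangementCount_eq (t : Fin n → ℕ) :
    genDerangementCount t = fibreDerangementCount (Sigma.fst : (Σ i, Fin (t i)) → Fin n) := rfl

theorem natCard_fibre_sigma (t : Fin n → ℕ) (i : Fin n) :
    Nat.card {x : Σ i, Fin (t i) // x.1 = i} = t i := by
  rw [Nat.card_congr (Equiv.sigmaSubtype i), Nat.card_fin]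

theorem natCard_fibre_adjoinPoint {X ι : Type*} [Finite X] [DecidableEq ι] (c : X → ι) (i j : ι) :
    Nat.card {x // adjoinPoint c i x = j} =
      Nat.card {x // c x = j} + (Pi.single i 1 : ι → ℕ) j := by
  classical
  have := Fintype.ofFinite X
  rw [natCard_subtype_eq_sum, natCard_subtype_eq_sum, Fintype.sum_option, add_comm]
  simp only [adjoinPoint, Option.elim_none, Option.elim_some, Pi.single_apply,
    eq_comm (a := j) (b := i)]
  congr

theorem genDerangementCount_add_single (t : Fin n → ℕ) (i : Fin n) :
    genDerangementCount (t + Pi.single i 1) =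
      fibreDerangementCount (adjoinPoint (Sigma.fst : (Σ i, Fin (t i)) → Fin n) i) := by
  rw [genDerangementCount_eq]
  refine fibreDerangementCount_eq_of_card_fibre _ _ fun j => ?_
  rw [natCard_fibre_sigma, natCard_fibre_adjoinPoint, natCard_fibre_sigma, Pi.add_apply]

theorem defectCount_congr {X Y ι : Type*} (c : X → ι) (d : Y → ι) (i : ι) (e : X ≃ Y)
    (he : ∀ x, d (e x) = c x) : defectCount c i = defectCount d i := by
  refine Nat.card_congr (Equiv.subtypeEquiv (e.prodCongr e.permCongr) ?_)
  rintro ⟨y, τ⟩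
  have h1 : ∀ x, (e.permCongr τ) (e x) = e (τ x) := fun x => by simp
  have h2 : (e.permCongr τ).symm (e y) = e (τ.symm y) := by
    rw [Equiv.symm_apply_eq, h1, Equiv.apply_symm_apply]
  simp only [IsFibreDerangementOff, Equiv.prodCongr_apply, Prod.map_apply, h2, he,
    e.surjective.forall, h1, Ne, e.injective.eq_iff]

theorem defectCount_sigma (t : Fin n → ℕ) (i : Fin n) :
    defectCount (Sigma.fst : (Σ i, Fin (t i)) → Fin n) i =
      t i ^ 2 * genDerangementCount (t - Pi.single i 1) := by
  -- If `t i = 0` the truncated `t - Pi.single i 1` is `t` itself, but its coefficient vanishes.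
  rcases Nat.eq_zero_or_pos (t i) with h0 | hpos
  · rw [h0, defectCount_eq_zero]
    · simp
    · rintro ⟨j, x⟩ rfl
      exact absurd x.2 (by simp [h0])
  · obtain ⟨s, rfl⟩ : ∃ s : Fin n → ℕ, t = s + Pi.single i 1 := by
      refine ⟨t - Pi.single i 1, (tsub_add_cancel_of_le ?_).symm⟩
      intro j
      rcases eq_or_ne j i with rfl | hj
      · simpa using Nat.succ_le_of_lt hpos
      · simp [hj]
    have hfib : ∀ j, Nat.card {x : Σ j, Fin ((s + Pi.single i 1 : Fin n → ℕ) j) // x.1 = j} =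
        Nat.card {x // adjoinPoint (Sigma.fst : (Σ j, Fin (s j)) → Fin n) i x = j} := by
      intro j
      rw [natCard_fibre_sigma, natCard_fibre_adjoinPoint, natCard_fibre_sigma, Pi.add_apply]
    obtain ⟨e, he⟩ := exists_equiv_of_card_fibre _ _ hfib
    rw [defectCount_congr _ _ i e he, defectCount_adjoinPoint, ← hfib, natCard_fibre_sigma,
      add_tsub_cancel_right]
    rfl

theorem genDerangementCount_recurrence (t : Fin n → ℕ) (i : Fin n) :
    genDerangementCount (t + Pi.single i 1) + 2 * (t i * genDerangementCount t) +
      t i ^ 2 * genDerangementCount (t - Pi.single i 1) =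
      offCount (Sigma.fst : (Σ i, Fin (t i)) → Fin n) := by
  rw [← fibreDerangementCount_adjoinPoint_add _ i, natCard_fibre_sigma, defectCount_sigma,
    genDerangementCount_add_single, genDerangementCount_eq t]

theorem genDerangementCount_comp_perm (t : Fin n → ℕ) (π : Perm (Fin n)) :
    genDerangementCount (fun i => t (π i)) = genDerangementCount t := by
  let e : (Σ i, Fin (t (π i))) ≃ Σ i, Fin (t i) :=
    π.sigmaCongrLeft (β := fun i => Fin (t i))
  exact fibreDerangementCount_congr _ _ e fun x y => π.injective.eq_iff

/-- Moving a unit from a larger entry to a smaller one does not decrease the number of generalized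
derangements. -/
theorem genDerangementCount_transfer (t : Fin n → ℕ) {i j : Fin n} (hij : i ≠ j)
    (h : t j ≤ t i) :
    genDerangementCount (t + Pi.single i 1) ≤ genDerangementCount (t + Pi.single j 1) := by
  induction hb : t j generalizing t with
  | zero =>
    have hi := genDerangementCount_recurrence t i
    have hj := genDerangementCount_recurrence t j
    rw [hb] at hj
    -- With `t j = 0` the recurrence at `j` reduces to its first term.
    omega
  | succ b ih =>
    have hi := genDerangementCount_recurrence t i
    have hj := genDerangementCount_recurrence t j
    -- Both entries are positive. Then `t - e_i = s + e_j` and `t - e_j = s + e_i`, the two sides of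
    -- the induction hypothesis for `s`.
    obtain ⟨s, rfl⟩ : ∃ s : Fin n → ℕ, t = s + Pi.single i 1 + Pi.single j 1 := by
      refine ⟨fun k => t k - (Pi.single i 1 : Fin n → ℕ) k - (Pi.single j 1 : Fin n → ℕ) k, ?_⟩
      ext k
      simp only [Pi.add_apply, Pi.single_apply]
      split_ifs with h1 h2 h2
      · exact absurd (h1.symm.trans h2) hij
      · subst h1; omega
      · subst h2; omega
      · omega
    rw [add_tsub_cancel_right] at hj
    rw [add_right_comm s, add_tsub_cancel_right, add_right_comm s] at hi
    have hsj : (s + Pi.single i 1 + Pi.single j 1 : Fin n → ℕ) j = s j + 1 := by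
      simp [hij.symm]
    have hsi : (s + Pi.single i 1 + Pi.single j 1 : Fin n → ℕ) i = s i + 1 := by
      simp [hij]
    rw [hsi] at hi h
    rw [hsj] at hj hb h
    have hstep := ih s (by omega) (by omega)
    set A := genDerangementCount (s + Pi.single i 1)
    set B := genDerangementCount (s + Pi.single j 1)
    set C := genDerangementCount (s + Pi.single i 1 + Pi.single j 1)
    have h1 : (s j + 1) * C ≤ (s i + 1) * C := Nat.mul_le_mul_right _ h
    have h2 : (s j + 1) ^ 2 * A ≤ (s i + 1) ^ 2 * B :=
      Nat.mul_le_mul (Nat.pow_le_pow_left h 2) hstep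
    omega

end Recurrence

/-! ### Reduction of majorization to unit transfers -/

section Majorization

variable {n : ℕ}

theorem genDerangementCount_decreasingRearrangement (a : Fin n → ℕ) :
    genDerangementCount (decreasingRearrangement a) = genDerangementCount a :=
  genDerangementCount_comp_perm a (Fin.revPerm.trans (Tuple.sort a))

theorem sum_decreasingRearrangement (a : Fin n → ℕ) :
    ∑ i, decreasingRearrangement a i = ∑ i, a i :=
  Equiv.sum_comp (Fin.revPerm.trans (Tuple.sort a)) a

/-- If the initial sums of `a` are at least those of the decreasing sequence `b` and the total sums
agree, then `a` is `b` or some unit can be moved to the right in `a`, towards an entry smaller by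
at least two, so that this is preserved. -/
theorem exists_transfer {a b : Fin n → ℕ} (hb : Antitone b)
    (hle : ∀ k ≤ n, ∑ i with (i : Fin n).val < k, b i ≤ ∑ i with (i : Fin n).val < k, a i)
    (hsum : ∑ i, a i = ∑ i, b i) (hne : a ≠ b) :
    ∃ (t : Fin n → ℕ) (i j : Fin n), i ≠ j ∧ a = t + Pi.single i 1 ∧ t j ≤ t i ∧ b i ≤ t i ∧
      t j < b j ∧ ∀ k ≤ n, ∑ l with (l : Fin n).val < k, b l ≤
        ∑ l with (l : Fin n).val < k, (t + Pi.single j 1 : Fin n → ℕ) l := by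
  have hex : ∃ m, ∃ hm : m < n, a ⟨m, hm⟩ < b ⟨m, hm⟩ := by
    by_contra! hcon
    have hba : ∀ i ∈ (univ : Finset (Fin n)), b i ≤ a i := fun i _ => hcon i.1 i.2
    exact hne (funext fun i =>
      ((Finset.sum_eq_sum_iff_of_le hba).1 hsum.symm i (Finset.mem_univ i)).symm)
  classical
  obtain ⟨hm, hlt⟩ := Nat.find_spec hex
  set j : Fin n := ⟨Nat.find hex, hm⟩ with hj
  have hmin : ∀ l < j, b l ≤ a l := by
    intro l hl
    by_contra! h
    exact Nat.find_min hex hl ⟨l.2, h⟩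
  -- `j` is the first deficit; without an earlier surplus the initial sum through `j` would be too
  -- small.
  have hi : ∃ i < j, b i < a i := by
    by_contra! hcon
    refine absurd (hle (j.val + 1) j.2) (not_le.2 ?_)
    refine Finset.sum_lt_sum (fun l hl => ?_) ⟨j, by simp, hlt⟩
    rcases eq_or_ne l j with rfl | hlj
    · exact hlt.le
    · have : l.val < j.val + 1 := by simpa using hl
      exact hcon l (lt_of_le_of_ne (Nat.lt_succ_iff.1 this) hlj)
  obtain ⟨i, hij, hbi⟩ := hi
  have hbij : b j ≤ b i := hb hij.le
  have ha : a = (a - Pi.single i 1) + Pi.single i 1 := by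
    refine (tsub_add_cancel_of_le fun l => ?_).symm
    rcases eq_or_ne l i with rfl | hl
    · simp; omega
    · simp [hl]
  obtain ⟨t, rfl⟩ : ∃ t : Fin n → ℕ, a = t + Pi.single i 1 := ⟨_, ha⟩
  have hti : (t + Pi.single i 1 : Fin n → ℕ) i = t i + 1 := by simp
  have htj : ∀ l, l ≠ i → (t + Pi.single i 1 : Fin n → ℕ) l = t l := by
    intro l hl; simp [hl]
  rw [hti] at hbi
  rw [htj j hij.ne'] at hlt
  refine ⟨t, i, j, hij.ne, rfl, by omega, by omega, hlt, fun k hk => ?_⟩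
  -- Up to `j` the bound holds termwise, even after the loss at `i`; beyond `j` both entries are
  -- included and the sum is unchanged.
  rcases le_or_gt k j.val with hkj | hkj
  · refine Finset.sum_le_sum fun l hl => ?_
    have hl' : l.val < k := by simpa using hl
    have := hmin l (show l.val < j.val by omega)
    rcases eq_or_ne l i with rfl | hli
    · simp only [Pi.add_apply]; omega
    · rw [htj l hli] at this
      simp only [Pi.add_apply]; omega
  · refine (hle k hk).trans_eq ?_
    have hik : i.val < k := lt_trans hij hkj
    simp only [Pi.add_apply, Finset.sum_add_distrib, Pi.single_apply,
      Finset.sum_ite_eq', Finset.mem_filter, Finset.mem_univ, true_and, hkj, hik, if_true]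

/-- Only `b` need be sorted, so `a` is never rearranged after a transfer. The total deficit
(truncated differences) drops: entry `j` gains a needed unit, and entry `i` stays at least `b i`. -/
theorem genDerangementCount_le_of_initial_sums {b : Fin n → ℕ} (hb : Antitone b) (a : Fin n → ℕ)
    (hle : ∀ k ≤ n, ∑ i with (i : Fin n).val < k, b i ≤ ∑ i with (i : Fin n).val < k, a i)
    (hsum : ∑ i, a i = ∑ i, b i) : genDerangementCount a ≤ genDerangementCount b := by
  induction hd : ∑ i, (b i - a i) using Nat.strong_induction_on generalizing a with
  | _ d ih =>
    by_cases hne : a = b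
    · rw [hne]
    obtain ⟨t, i, j, hij, rfl, hji, hbi, hbj, hle'⟩ := exists_transfer hb hle hsum hne
    refine (genDerangementCount_transfer t hij hji).trans (ih _ ?_ _ hle' ?_ rfl)
    · rw [← hd]
      refine Finset.sum_lt_sum (fun l _ => ?_) ⟨j, Finset.mem_univ j, ?_⟩
      · rcases eq_or_ne l i with rfl | hl
        · simp only [Pi.add_apply]; omega
        · simp only [Pi.add_apply, Pi.single_eq_of_ne hl]; omega
      · simp only [Pi.add_apply, Pi.single_eq_same, Pi.single_eq_of_ne hij.symm]; omega
    · rw [← hsum]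
      simp [Finset.sum_add_distrib]

end Majorization

theorem theorem4p2 (n : ℕ) (a b : Fin n → ℕ) (hab : Majorizes a b) :
    genDerangementCount a ≤ genDerangementCount b := by
  rw [← genDerangementCount_decreasingRearrangement a,
    ← genDerangementCount_decreasingRearrangement b]
  refine genDerangementCount_le_of_initial_sums (antitone_decreasingRearrangement b) _ hab.1 ?_
  rw [sum_decreasingRearrangement, sum_decreasingRearrangement, hab.2]
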